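/- Throughout, rings are associative with identity and modules are unitary left modules. A submodule $N$ of a module $M$ is superfluous if $N+L=M$ for a submodule $L\subseteq M$ implies $L=M$. A projective cover of $M$ is a projective module $P$ together with an epimorphism $\pi:P\to M$ whose kernel is superfluous in $P$. A ring $R$ is perfect if every $R$-module $M$ has a projective cover; a choice of one is denoted $\pi_M:P_R(M)\to M$. A nonzero module $M$ is indecomposable if $M=N_1\oplus N_2$ with submodules $N_1,N_2$ implies $N_1=0$ or $N_2=0$. A module $M$ is sum-irreducible if $M=N_1+N_2$ with submodules $N_1,N_2$ implies $N_1=M$ or $N_2=M$. **Theorem 3.5 (= Theorem 1.1).** Let $R$ be a perfect ring and $P$ a nonzero $R$-module. The following assertions are equivalent: - (i) $P$ is indecomposable and projective. - (ii) $P$ is sum-irreducible and projective. - (iii) $P$ is the projective cover of each of its nonzero quotient modules, by means of the natural map: for every proper submodule $N\subsetneq P$, the natural epimorphism $P\to P/N$ is a projective cover of $P/N$. - (iii$'$) For every proper submodule $N\subsetneq P$ there is some homomorphism $P\to P/N$ that is a projective cover of $P/N$. - (iv) $P\cong P_R(R/\mathfrak m)$ for some maximal left ideal $\mathfrak m$ of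 $R$. If moreover $R$ is commutative, these assertions are also equivalent to: - (v) $P\cong R_{\mathfrak m}$ as $R$-modules for some maximal ideal $\mathfrak m$ of $R$. -/

import Mathlib

universe u v

/-- A submodule `N` of `M` is superfluous if `N + L = M` forces `L = M`. -/
def IsSuperfluous {R : Type u} [Ring R] {M : Type v} [AddCommGroup M] [Module R M]
    (N : Submodule R M) : Prop :=
  ∀ L : Submodule R M, N ⊔ L = ⊤ → L = ⊤

/-- `π : P → M` is a projective cover of `M`: the module `P` is projective, `π` is an epimorphism,
and its kernel is superfluous in `P`. -/
structure IsProjectiveCover {R : Type u} [Ring R] {P M : Type v} [AddCommGroup P] [Module R P]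
    [AddCommGroup M] [Module R M] (π : P →ₗ[R] M) : Prop where
  projective : Module.Projective R P
  surjective : Function.Surjective π
  superfluous : IsSuperfluous (LinearMap.ker π)

/-- A projective cover of `M`, as an object: a module together with a covering map onto `M`. -/
structure ProjectiveCover (R : Type u) [Ring R] (M : Type v) [AddCommGroup M] [Module R M] where
  carrier : Type v
  [addCommGroup : AddCommGroup carrier]
  [module : Module R carrier]
  π : carrier →ₗ[R] M
  isProjectiveCover : IsProjectiveCover π

attribute [instance] ProjectiveCover.addCommGroup ProjectiveCover.module

/-- A ring is (left) perfect if every left module has a projective cover. -/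
def IsPerfectRing (R : Type u) [Ring R] : Prop :=
  ∀ (M : Type u) [AddCommGroup M] [Module R M], Nonempty (ProjectiveCover R M)

/-- A choice `P_R(M)` of a projective cover of the module `M` over the perfect ring `R`. -/
noncomputable def IsPerfectRing.cover {R : Type u} [Ring R] (hR : IsPerfectRing R)
    (M : Type u) [AddCommGroup M] [Module R M] : ProjectiveCover R M :=
  (hR M).some

/-- A nonzero module is indecomposable if, whenever it is the internal direct sum of two
submodules, one of them is zero. -/
def IsIndecomposableModule (R : Type u) [Ring R] (M : Type v) [AddCommGroup M] [Module R M] :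
    Prop :=
  Nontrivial M ∧ ∀ N₁ N₂ : Submodule R M, IsCompl N₁ N₂ → N₁ = ⊥ ∨ N₂ = ⊥

/-- A module is sum-irreducible if, whenever it is the sum of two submodules, one of them is
the whole module. -/
def IsSumIrreducible (R : Type u) [Ring R] (M : Type v) [AddCommGroup M] [Module R M] : Prop :=
  ∀ N₁ N₂ : Submodule R M, N₁ ⊔ N₂ = ⊤ → N₁ = ⊤ ∨ N₂ = ⊤

/-! The pivot is a superfluous maximal submodule `K`: anything not inside `K` is then the whole
module, so two proper submodules cannot sum to it. The kernel of a projective cover of a simple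
module is such a `K`. Conversely, for `P` projective, `P → P ⧸ N` lifts to a split epimorphism onto
the cover of `P ⧸ N`; if `P` is indecomposable and `N` proper, this is an isomorphism. To reach
simple quotients, a nonzero projective needs a maximal submodule
(`Module.Projective.exists_isCoatom`). In the commutative case the cover of `R ⧸ m` is cyclic, and
its generator exhibits it as `R` localized at `m`. -/

/-- Vectors over a ring fixed by a finite matrix with entries in the Jacobson radical vanish. -/
theorem Ring.eq_zero_of_eq_sum_mul_jacobson {R : Type*} [Ring R] {ι : Type*} (S : Finset ι)
    (a : ι → R) (B : ι → ι → R) (hB : ∀ i j, B i j ∈ Ring.jacobson R)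
    (h : ∀ j ∈ S, a j = ∑ i ∈ S, a i * B i j) : ∀ j ∈ S, a j = 0 := by
  classical
  have left_inv : ∀ b ∈ Ring.jacobson R, ∃ u : R, u * (1 - b) = 1 := by
    intro b hb
    rw [← Ideal.jacobson_bot, Ideal.mem_jacobson_iff] at hb
    obtain ⟨z, hz⟩ := hb (-1)
    refine ⟨z, ?_⟩
    rw [Ideal.mem_bot, sub_eq_zero] at hz
    calc z * (1 - b) = z * -1 * b + z := by noncomm_ring
      _ = 1 := hz
  have right_inv : ∀ b ∈ Ring.jacobson R, ∃ u : R, (1 - b) * u = 1 := by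
    intro b hb
    obtain ⟨u, hu⟩ := left_inv b hb
    -- The left inverse `u` equals `1 + u * b`, so it has a left inverse too and is a unit.
    obtain ⟨v, hv⟩ := left_inv (-(u * b)) (neg_mem ((Ring.jacobson R).mul_mem_left u hb))
    have hu' : 1 - -(u * b) = u := by
      rw [mul_sub, mul_one, sub_eq_iff_eq_add] at hu
      rw [sub_neg_eq_add, ← hu]
    rw [hu'] at hv
    have : v = 1 - b := left_inv_eq_right_inv hv hu
    exact ⟨u, this ▸ hv⟩
  induction S using Finset.induction_on generalizing B with
  | empty => simp
  | insert k S hk ih =>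
    obtain ⟨u, hu⟩ := right_inv _ (hB k k)
    have hak : a k = ∑ i ∈ S, a i * (B i k * u) := by
      have := h k (Finset.mem_insert_self k S)
      rw [Finset.sum_insert hk, ← sub_eq_iff_eq_add'] at this
      calc a k = (a k - a k * B k k) * u := by rw [← mul_one_sub, mul_assoc, hu, mul_one]
        _ = _ := by rw [this, Finset.sum_mul]; simp only [mul_assoc]
    have hS : ∀ j ∈ S, a j = 0 := by
      -- Eliminating `a k` leaves a smaller system whose entries stay in the radical, a left ideal.
      refine ih (fun i j ↦ B i j + B i k * u * B k j)
        (fun i j ↦ add_mem (hB i j) ((Ring.jacobson R).mul_mem_left _ (hB k j))) fun j hj ↦ ?_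
      have := h j (Finset.mem_insert_of_mem hj)
      rw [Finset.sum_insert hk] at this
      rw [this]
      nth_rw 1 [hak]
      simp only [mul_add, Finset.sum_add_distrib, Finset.sum_mul, mul_assoc]
      rw [add_comm]
    intro j hj
    obtain rfl | hj := Finset.mem_insert.mp hj
    · rw [hak]
      exact Finset.sum_eq_zero fun i hi ↦ by rw [hS i hi, zero_mul]
    · exact hS j hj

/-- A nonzero projective module has a maximal submodule. -/
theorem Module.Projective.exists_isCoatom (R : Type*) [Ring R] (P : Type*) [AddCommGroup P]
    [Module R P] [Module.Projective R P] [Nontrivial P] : ∃ K : Submodule R P, IsCoatom K := by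
  by_contra! hP
  have htop : Module.jacobson R P = ⊤ := by
    rw [Module.jacobson, sInf_eq_top]
    exact fun K hK ↦ (hP K hK).elim
  obtain ⟨s, hs⟩ := Module.projective_def.mp ‹Module.Projective R P›
  obtain ⟨x, hx⟩ := exists_ne (0 : P)
  apply hx
  rw [← hs x]
  suffices s x = 0 by rw [this, map_zero]
  -- Coordinate functionals of `s` map `P`, now its own radical, into the Jacobson radical. Applying
  -- `s` to the expansion of `x` shows that its coordinate vector is fixed by the matrix `s i j`.
  have key := Ring.eq_zero_of_eq_sum_mul_jacobson (s x).support (s x) (fun i j ↦ s i j)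
    (fun i j ↦ Module.le_comap_jacobson ((Finsupp.lapply j).comp s)
      (htop ▸ Submodule.mem_top : i ∈ Module.jacobson R P))
    (fun j _ ↦ by
      conv_lhs => rw [← hs x]
      rw [Finsupp.linearCombination_apply, Finsupp.sum, map_sum, Finsupp.finsetSum_apply]
      simp)
  ext j
  by_cases hj : j ∈ (s x).support
  · exact key j hj
  · simpa using hj

section Cover

variable {R : Type u} [Ring R] {P Q M : Type v} [AddCommGroup P] [Module R P]
  [AddCommGroup Q] [Module R Q] [AddCommGroup M] [Module R M]

/-- An epimorphism from a projective module factors through any projective cover by an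
epimorphism. -/
theorem IsProjectiveCover.exists_surjective_lift [Module.Projective R P] {π : Q →ₗ[R] M}
    (hπ : IsProjectiveCover π) {f : P →ₗ[R] M} (hf : Function.Surjective f) :
    ∃ g : P →ₗ[R] Q, Function.Surjective g ∧ π ∘ₗ g = f := by
  obtain ⟨g, hg⟩ := Module.projective_lifting_property π f hπ.surjective
  -- It suffices that `ker π` and the range of `g` span `Q`.
  refine ⟨g, LinearMap.range_eq_top.mp (hπ.superfluous _ ?_), hg⟩
  rw [eq_top_iff]
  intro q _
  obtain ⟨p, hp⟩ := hf (π q)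
  have : q = (q - g p) + g p := by abel
  rw [this]
  refine Submodule.add_mem_sup ?_ ⟨p, rfl⟩
  rw [LinearMap.mem_ker, map_sub, ← hp, ← hg, LinearMap.comp_apply, sub_self]

theorem IsSuperfluous.comap_equiv {K : Submodule R M} (hK : IsSuperfluous K) (e : P ≃ₗ[R] M) :
    IsSuperfluous (K.comap (e : P →ₗ[R] M)) := by
  intro L hL
  have := congrArg (Submodule.map (e : P →ₗ[R] M)) hL
  rw [Submodule.map_sup, Submodule.map_comap_eq_of_surjective e.surjective, Submodule.map_top,
    LinearEquiv.range] at this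
  rw [← Submodule.comap_map_eq_of_injective e.injective L, hK _ this, Submodule.comap_top]

theorem IsProjectiveCover.comp_equiv {π : Q →ₗ[R] M} (hπ : IsProjectiveCover π) (e : P ≃ₗ[R] Q) :
    IsProjectiveCover (π ∘ₗ (e : P →ₗ[R] Q)) where
  projective := have := hπ.projective; Module.Projective.of_equiv e.symm
  surjective := hπ.surjective.comp e.surjective
  superfluous := by
    rw [LinearMap.ker_comp]
    exact hπ.superfluous.comap_equiv e

theorem IsProjectiveCover.equiv_comp {N : Type v} [AddCommGroup N] [Module R N] {π : Q →ₗ[R] M}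
    (hπ : IsProjectiveCover π) (e : M ≃ₗ[R] N) :
    IsProjectiveCover ((e : M →ₗ[R] N) ∘ₗ π) where
  projective := hπ.projective
  surjective := e.surjective.comp hπ.surjective
  superfluous := by
    rw [LinearEquiv.ker_comp]
    exact hπ.superfluous

/-- Projective covers are unique up to isomorphism. -/
theorem IsProjectiveCover.nonempty_linearEquiv {π : P →ₗ[R] M} (hπ : IsProjectiveCover π)
    {π' : Q →ₗ[R] M} (hπ' : IsProjectiveCover π') : Nonempty (P ≃ₗ[R] Q) := by
  have := hπ.projective
  have := hπ'.projective
  obtain ⟨g, hg, hgπ⟩ := hπ'.exists_surjective_lift hπ.surjective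
  obtain ⟨s, hs⟩ := g.exists_rightInverse_of_surjective (LinearMap.range_eq_top.mpr hg)
  have hs' : ∀ q, g (s q) = q := fun q ↦ LinearMap.congr_fun hs q
  have hrange : LinearMap.range s = ⊤ := by
    apply hπ.superfluous
    rw [eq_top_iff]
    intro p _
    have : p = (p - s (g p)) + s (g p) := by abel
    rw [this]
    refine Submodule.add_mem_sup ?_ ⟨g p, rfl⟩
    rw [LinearMap.mem_ker, ← hgπ, LinearMap.comp_apply, map_sub, hs', sub_self, map_zero]
  exact ⟨(LinearEquiv.ofBijective s
    ⟨Function.LeftInverse.injective hs', LinearMap.range_eq_top.mp hrange⟩).symm⟩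

/-- A module with a superfluous maximal submodule is sum-irreducible. -/
theorem IsSuperfluous.isSumIrreducible {K : Submodule R M} (hK : IsSuperfluous K)
    (hK' : IsCoatom K) : IsSumIrreducible R M := by
  intro N₁ N₂ h
  by_cases h₁ : N₁ ≤ K
  · by_cases h₂ : N₂ ≤ K
    · exact (hK'.1 (top_le_iff.mp (h ▸ sup_le h₁ h₂))).elim
    · exact .inr (hK _ (hK'.2 _ (left_lt_sup.mpr h₂)))
  · exact .inl (hK _ (hK'.2 _ (left_lt_sup.mpr h₁)))

theorem LinearMap.isCoatom_ker [IsSimpleModule R M] {π : P →ₗ[R] M}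
    (hπ : Function.Surjective π) : IsCoatom (LinearMap.ker π) := by
  rw [← isSimpleModule_iff_isCoatom]
  exact (π.quotKerEquivOfSurjective hπ).isSimpleModule_iff.mpr inferInstance

theorem IsProjectiveCover.isSumIrreducible [IsSimpleModule R M] {π : P →ₗ[R] M}
    (hπ : IsProjectiveCover π) : IsSumIrreducible R P :=
  hπ.superfluous.isSumIrreducible (LinearMap.isCoatom_ker hπ.surjective)

theorem IsSumIrreducible.isSuperfluous (h : IsSumIrreducible R M) {N : Submodule R M}
    (hN : N ≠ ⊤) : IsSuperfluous N :=
  fun L hL ↦ (h N L hL).resolve_left hN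

theorem IsSumIrreducible.isIndecomposableModule [Nontrivial M] (h : IsSumIrreducible R M) :
    IsIndecomposableModule R M := by
  refine ⟨inferInstance, fun N₁ N₂ hN ↦ ?_⟩
  obtain rfl | rfl := h N₁ N₂ hN.sup_eq_top
  · exact .inr (top_disjoint.mp hN.disjoint)
  · exact .inl (disjoint_top.mp hN.disjoint)

/-- A proper submodule `N` of an indecomposable projective module `P` is superfluous as soon as
`P ⧸ N` has a projective cover. -/
theorem IsIndecomposableModule.isProjectiveCover_mkQ [Module.Projective R P]
    (hP : IsIndecomposableModule R P) {N : Submodule R P} (hN : N ≠ ⊤) {π : Q →ₗ[R] P ⧸ N}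
    (hπ : IsProjectiveCover π) : IsProjectiveCover N.mkQ := by
  have := hπ.projective
  obtain ⟨g, hg, hgπ⟩ := hπ.exists_surjective_lift N.mkQ_surjective
  obtain ⟨s, hs⟩ := g.exists_rightInverse_of_surjective (LinearMap.range_eq_top.mpr hg)
  have hs' : ∀ q, g (s q) = q := fun q ↦ LinearMap.congr_fun hs q
  have hcompl : IsCompl (LinearMap.range s) (LinearMap.ker g) := by
    refine ⟨Submodule.disjoint_def.mpr ?_, codisjoint_iff.mpr (eq_top_iff.mpr fun p _ ↦ ?_)⟩
    · rintro _ ⟨q, rfl⟩ hq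
      rw [LinearMap.mem_ker, hs'] at hq
      rw [hq, map_zero]
    · have : p = s (g p) + (p - s (g p)) := by abel
      rw [this]
      refine Submodule.add_mem_sup ⟨g p, rfl⟩ ?_
      rw [LinearMap.mem_ker, map_sub, hs', sub_self]
  obtain h | h := hP.2 _ _ hcompl
  -- If the range of `s` vanishes, then `g = 0`, so `N.mkQ = 0`.
  · refine (hN (eq_top_iff.mpr fun p _ ↦ ?_)).elim
    have hgp : s (g p) = 0 := (Submodule.mem_bot R).mp (h ▸ LinearMap.mem_range_self s (g p))
    rw [← N.ker_mkQ, LinearMap.mem_ker, ← hgπ, LinearMap.comp_apply, ← hs' (g p), hgp, map_zero,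
      map_zero]
  · rw [← hgπ]
    exact hπ.comp_equiv (LinearEquiv.ofBijective g ⟨LinearMap.ker_eq_bot.mp h, hg⟩)

end Cover

theorem IsProjectiveCover.exists_isMaximal_linearEquiv_cover {R : Type u} [Ring R]
    (hR : IsPerfectRing R) {P : Type u} [AddCommGroup P] [Module R P] {K : Submodule R P}
    (hK : IsCoatom K) (hP : IsProjectiveCover K.mkQ) :
    ∃ m : Ideal R, m.IsMaximal ∧ Nonempty (P ≃ₗ[R] (hR.cover (R ⧸ m)).carrier) := by
  obtain ⟨m, hm, ⟨e⟩⟩ := isSimpleModule_iff_quot_maximal.mp (isSimpleModule_iff_isCoatom.mpr hK)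
  exact ⟨m, hm, IsProjectiveCover.nonempty_linearEquiv
    (hP.equiv_comp e) (hR.cover (R ⧸ m)).isProjectiveCover⟩

/-- Over a commutative ring, a projective cover of `R ⧸ m` is a localization of `R` at `m`. -/
theorem IsProjectiveCover.exists_isLocalizedModule {R : Type u} [CommRing R] {Q : Type u}
    [AddCommGroup Q] [Module R Q] (m : Ideal R) [m.IsMaximal] {π : Q →ₗ[R] R ⧸ m}
    (hπ : IsProjectiveCover π) :
    ∃ g : R →ₗ[R] Q, IsLocalizedModule m.primeCompl g := by
  have := hπ.projective
  have : IsSimpleModule R (R ⧸ m) := isSimpleModule_iff_isCoatom.mpr (Ideal.isMaximal_def.mp ‹_›)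
  have hK := LinearMap.isCoatom_ker hπ.surjective
  obtain ⟨x, hx⟩ := hπ.surjective (Submodule.Quotient.mk 1)
  have hπx (r : R) : π (r • x) = 0 ↔ r ∈ m := by
    rw [map_smul, hx, ← Submodule.Quotient.mk_smul, Submodule.Quotient.mk_eq_zero, smul_eq_mul,
      mul_one]
  have eq_top {L : Submodule R Q} {r : R} (hr : r ∉ m) (hL : r • x ∈ L) : L = ⊤ :=
    hπ.superfluous _ (hK.2 _ (left_lt_sup.mpr fun hle ↦ hr ((hπx r).mp (hle hL))))
  have one_notMem : (1 : R) ∉ m := m.ne_top_iff_one.mp (Ideal.IsMaximal.ne_top ‹_›)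
  set g := LinearMap.toSpanSingleton R Q x with hg_def
  have hg : Function.Surjective g :=
    LinearMap.range_eq_top.mp (eq_top one_notMem ⟨1, rfl⟩)
  have : Module.Finite R Q := Module.Finite.of_surjective g hg
  obtain ⟨σ, hσ⟩ := g.exists_rightInverse_of_surjective (LinearMap.range_eq_top.mpr hg)
  have hσx : σ x • x = x := LinearMap.congr_fun hσ x
  have hσm : σ x ∉ m := by
    rw [← hπx, hσx, ← one_smul R x, hπx]
    exact one_notMem
  -- Elements outside `m` act surjectively, hence bijectively as `Q` is finite. Applying `σ` to `r₁
  -- • x = r₂ • x` shows that `σ x`, which lies outside `m`, equalizes `r₁` and `r₂`.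
  refine ⟨g, ⟨fun s ↦ ?_, fun y ↦ ?_, fun {r₁ r₂} h ↦ ⟨⟨σ x, hσm⟩, ?_⟩⟩⟩
  · rw [Module.End.isUnit_iff]
    have hs : Function.Surjective (algebraMap R (Module.End R Q) s) :=
      LinearMap.range_eq_top.mp (eq_top s.2 ⟨x, rfl⟩)
    exact ⟨OrzechProperty.injective_of_surjective_endomorphism _ hs, hs⟩
  · obtain ⟨r, rfl⟩ := hg y
    exact ⟨(r, 1), one_smul _ _⟩
  · have := congrArg σ h
    simp only [hg_def, LinearMap.toSpanSingleton_apply, map_smul, smul_eq_mul] at this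
    rwa [mul_comm, mul_comm r₂] at this

theorem IsProjectiveCover.nonempty_linearEquiv_localization {R : Type u} [CommRing R] {Q : Type u}
    [AddCommGroup Q] [Module R Q] (m : Ideal R) [m.IsMaximal] {π : Q →ₗ[R] R ⧸ m}
    (hπ : IsProjectiveCover π) : Nonempty (Q ≃ₗ[R] Localization.AtPrime m) := by
  obtain ⟨g, hg⟩ := hπ.exists_isLocalizedModule
  exact ⟨IsLocalizedModule.linearEquiv m.primeCompl g
    (Algebra.linearMap R (Localization.AtPrime m))⟩

/-- The characterizations of indecomposable projective modules over a perfect ring. -/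
theorem IsPerfectRing.tfae_isIndecomposableModule_projective {R : Type u} [Ring R]
    (hR : IsPerfectRing R) (P : Type u) [AddCommGroup P] [Module R P] [Nontrivial P] :
    List.TFAE [
      IsIndecomposableModule R P ∧ Module.Projective R P,
      IsSumIrreducible R P ∧ Module.Projective R P,
      ∀ N : Submodule R P, N ≠ ⊤ → IsProjectiveCover N.mkQ,
      ∀ N : Submodule R P, N ≠ ⊤ → ∃ π : P →ₗ[R] P ⧸ N, IsProjectiveCover π,
      ∃ m : Ideal R, m.IsMaximal ∧ Nonempty (P ≃ₗ[R] (hR.cover (R ⧸ m)).carrier)] := by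
  tfae_have 2 → 1 := fun ⟨h, hP⟩ ↦ ⟨h.isIndecomposableModule, hP⟩
  tfae_have 1 → 3 := fun ⟨h, _⟩ N hN ↦
    h.isProjectiveCover_mkQ hN (hR.cover (P ⧸ N)).isProjectiveCover
  tfae_have 3 → 4 := fun h N hN ↦ ⟨N.mkQ, h N hN⟩
  tfae_have 4 → 2 := by
    intro h
    -- The case `N = ⊥` serves only to give projectivity of `P`.
    obtain ⟨_, hπ₀⟩ := h ⊥ bot_ne_top
    have hP := hπ₀.projective
    obtain ⟨K, hK⟩ := Module.Projective.exists_isCoatom R P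
    obtain ⟨π, hπ⟩ := h K hK.1
    have := isSimpleModule_iff_isCoatom.mpr hK
    exact ⟨hπ.isSumIrreducible, hP⟩
  tfae_have 3 → 5 := by
    intro h
    have := (h ⊥ bot_ne_top).projective
    obtain ⟨K, hK⟩ := Module.Projective.exists_isCoatom R P
    exact (h K hK.1).exists_isMaximal_linearEquiv_cover hR hK
  tfae_have 5 → 2 := by
    rintro ⟨m, hm, ⟨e⟩⟩
    have := isSimpleModule_iff_isCoatom.mpr (Ideal.isMaximal_def.mp hm)
    have hπ := (hR.cover (R ⧸ m)).isProjectiveCover.comp_equiv e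
    exact ⟨hπ.isSumIrreducible, hπ.projective⟩
  tfae_finish

theorem theorem3p5 :
    (∀ (R : Type u) [Ring R] (hR : IsPerfectRing R)
      (P : Type u) [AddCommGroup P] [Module R P] [Nontrivial P],
      List.TFAE [
        IsIndecomposableModule R P ∧ Module.Projective R P,
        IsSumIrreducible R P ∧ Module.Projective R P,
        ∀ N : Submodule R P, N ≠ ⊤ → IsProjectiveCover N.mkQ,
        ∀ N : Submodule R P, N ≠ ⊤ → ∃ π : P →ₗ[R] P ⧸ N, IsProjectiveCover π,
        ∃ m : Ideal R, m.IsMaximal ∧ Nonempty (P ≃ₗ[R] (hR.cover (R ⧸ m)).carrier)]) ∧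
    (∀ (R : Type u) [CommRing R] (hR : IsPerfectRing R)
      (P : Type u) [AddCommGroup P] [Module R P] [Nontrivial P],
      List.TFAE [
        IsIndecomposableModule R P ∧ Module.Projective R P,
        IsSumIrreducible R P ∧ Module.Projective R P,
        ∀ N : Submodule R P, N ≠ ⊤ → IsProjectiveCover N.mkQ,
        ∀ N : Submodule R P, N ≠ ⊤ → ∃ π : P →ₗ[R] P ⧸ N, IsProjectiveCover π,
        ∃ m : Ideal R, m.IsMaximal ∧ Nonempty (P ≃ₗ[R] (hR.cover (R ⧸ m)).carrier),
        ∃ m : MaximalSpectrum R, Nonempty (P ≃ₗ[R] Localization.AtPrime m.asIdeal)]) := by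
  refine ⟨fun R _ hR P _ _ _ ↦ hR.tfae_isIndecomposableModule_projective P,
    fun R _ hR P _ _ _ ↦ ?_⟩
  have h := hR.tfae_isIndecomposableModule_projective P
  tfae_have 1 ↔ 2 := h.out 0 1
  tfae_have 1 ↔ 3 := h.out 0 2
  tfae_have 1 ↔ 4 := h.out 0 3
  tfae_have 1 ↔ 5 := h.out 0 4
  tfae_have 5 → 6 := by
    rintro ⟨m, hm, ⟨e⟩⟩
    obtain ⟨e'⟩ := (hR.cover (R ⧸ m)).isProjectiveCover.nonempty_linearEquiv_localization
    exact ⟨⟨m, hm⟩, ⟨e.trans e'⟩⟩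
  tfae_have 6 → 5 := by
    rintro ⟨⟨m, hm⟩, ⟨e⟩⟩
    obtain ⟨e'⟩ := (hR.cover (R ⧸ m)).isProjectiveCover.nonempty_linearEquiv_localization
    exact ⟨m, hm, ⟨e.trans e'.symm⟩⟩
  tfae_finish
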